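/- Let $k \ge 1$ be an integer and let players join a queue according to a Poisson process of rate $\lambda > 0$ (independent, exponentially distributed inter-arrival times with rate $\lambda$). At time $0$ there are $X_0 \in \{0, \dots, k-1\}$ players in the queue, with $X_0$ random and independent of the arrival process. Consider any matchmaking mechanism: a (possibly random) collection of games, each game consisting of exactly $k$ players who have all joined the queue by the time it starts, no player being in two games, and such that, almost surely, players start a game as soon as there are at least $k$ of them in the queue, i.e. at no time do $k$ or more players remain waiting. The waiting time $T_n$ of the $n$-th arriving player ($n = 0, 1, 2, \dots$) is the time from joining the queue to the start of the player's game. Then every such mechanism yields the same expected waiting time $$\mathbb{E}[T] = \frac{k-1}{2\lambda},$$ in each of the following senses. 1. The system is in steady state (the distribution of the number of players in the queue is the same at all times $t \ge 0$) if and only if $X_0$ is uniformly distributed on $\{0, \dots, k-1\}$; and in steady state $\mathbb{E}[T_n] = \frac{k-1}{2\lambda}$ for every $n$. 2. For every distribution of $X_0$, the average expected waiting time satisfies $\lim_{N \to \infty} \frac1N \sum_{n<N} \mathbb{E}[T_n] = \frac{k-1}{2\lambda}$. 3. For every distribution of $X_0$, almost surely $\lim_{N \to \infty} \frac1N \sum_{n<N}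 T_n = \frac{k-1}{2\lambda}$. -/

import Mathlib

open MeasureTheory ProbabilityTheory Filter Topology
open scoped NNReal ENNReal

namespace Matchmaking

/-- Poisson arrivals at rate `lam`, described by their inter-arrival times: `gap 0` is the time
from `0` to the first arrival, `gap (n + 1)` the time between arrivals `n` and `n + 1`; the gaps
are independent and exponentially distributed with rate `lam`. -/
structure IsPoissonArrivals {Ω : Type*} [MeasurableSpace Ω] (P : Measure Ω) (lam : ℝ)
    (gap : ℕ → Ω → ℝ≥0) : Prop where
  measurable : ∀ n, Measurable (gap n)
  law : ∀ n, HasLaw (fun ω => (gap n ω : ℝ)) (expMeasure lam) P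
  indep : iIndepFun gap P

/-- Players are numbered `0, 1, 2, …`. The players `0, …, x - 1` are in the queue at time `0`;
player `x + n` is the `n`-th newcomer and joins the queue at time `gap 0 + ⋯ + gap n`.
(For `n < x` the truncated difference `n + 1 - x` is `0`, and the sum is empty.) -/
def arrivalTime (gap : ℕ → ℝ≥0) (x : ℕ) (n : ℕ) : ℝ≥0 :=
  ∑ i ∈ Finset.range (n + 1 - x), gap i

/-- A game: the set of its players and the time at which it starts. -/
structure Game where
  players : Finset ℕ
  time : ℝ≥0

/-- `G` is a possible set of `k`-player games when player `n` joins the queue at time `a n`: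
each game has exactly `k` players, all of whom have arrived when it starts, and no player is
in two games. -/
structure IsSchedule (k : ℕ) (a : ℕ → ℝ≥0) (G : Set Game) : Prop where
  card_eq : ∀ g ∈ G, g.players.card = k
  arrival_le : ∀ g ∈ G, ∀ n ∈ g.players, a n ≤ g.time
  disjoint : G.PairwiseDisjoint Game.players

/-- The time at which player `n` starts a game; it is `∞` if the player never gets into one. -/
noncomputable def startTime (G : Set Game) (n : ℕ) : ℝ≥0∞ :=
  ⨅ g ∈ G, ⨅ _ : n ∈ g.players, (g.time : ℝ≥0∞)

/-- The number of players in the queue at time `t`: those who have arrived and whose game has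
not started (games that start at time `t` count as started). -/
noncomputable def queueLength (a : ℕ → ℝ≥0) (G : Set Game) (t : ℝ≥0) : ℕ∞ :=
  {n : ℕ | a n ≤ t ∧ (t : ℝ≥0∞) < startTime G n}.encard

/-- Games start as soon as there are at least `k` players in the queue: at no time do `k` or
more players remain waiting. -/
def StartsPromptly (k : ℕ) (a : ℕ → ℝ≥0) (G : Set Game) : Prop :=
  ∀ t : ℝ≥0, queueLength a G t < k

/-- The waiting time of player `n`. -/
noncomputable def waitingTime (a : ℕ → ℝ≥0) (G : Set Game) (n : ℕ) : ℝ≥0∞ :=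
  startTime G n - a n

section Random

variable {Ω : Type*} {k : ℕ}

/-- The arrival times when `X₀ ω ∈ {0, …, k - 1}` players are in the queue at time `0`. -/
def arrivals (gap : ℕ → Ω → ℝ≥0) (X₀ : Ω → Fin k) (ω : Ω) : ℕ → ℝ≥0 :=
  arrivalTime (fun i => gap i ω) (X₀ ω)

/-- A matchmaking mechanism produces, for every outcome `ω`, a set `G ω` of games; almost surely
this is a possible set of `k`-player games, started as soon as `k` players are in the queue. -/
def IsPromptMechanism [MeasurableSpace Ω] (P : Measure Ω) (gap : ℕ → Ω → ℝ≥0)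
    (X₀ : Ω → Fin k) (G : Ω → Set Game) : Prop :=
  ∀ᵐ ω ∂P, IsSchedule k (arrivals gap X₀ ω) (G ω) ∧ StartsPromptly k (arrivals gap X₀ ω) (G ω)

/-- The waiting time of the `n`-th newcomer. -/
noncomputable def wait (gap : ℕ → Ω → ℝ≥0) (X₀ : Ω → Fin k) (G : Ω → Set Game) (n : ℕ)
    (ω : Ω) : ℝ≥0∞ :=
  waitingTime (arrivals gap X₀ ω) (G ω) (X₀ ω + n)

/-- The queue is in steady state: the law of the queue length does not change with time. -/
def InSteadyState [MeasurableSpace Ω] (P : Measure Ω) (gap : ℕ → Ω → ℝ≥0)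
    (X₀ : Ω → Fin k) (G : Ω → Set Game) : Prop :=
  ∀ (t : ℝ≥0) (j : ℕ), P {ω | queueLength (arrivals gap X₀ ω) (G ω) t = j} =
    P {ω | queueLength (arrivals gap X₀ ω) (G ω) 0 = j}

end Random

end Matchmaking

/-! Promptness leaves a mechanism no freedom in its timing. The players who have started by time `t`
form a union of disjoint `k`-sets and fewer than `k` remain, so division with remainder fixes both
counts: the queue length is the number arrived modulo `k`. As gaps are almost surely positive,
player `n` starts exactly when the last member of their block of `k` consecutive players arrives
(`StartsPromptly.startTime_eq`).

The `n`-th newcomer thus waits for `k - 1 - (X₀ + n) % k` gaps of mean `lam⁻¹`, and this count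
averages `(k - 1) / 2` over a full period, whether the averaging is over uniform `X₀` or over `n`.
The almost sure limit follows from the strong law along each residue class modulo `k`.

For the steady state, the queue length is `X₀ + Y_t` in the cyclic group of order `k`, with `Y_t`
the arrival count modulo `k`, independent of `X₀`. The uniform law is preserved. Conversely, `Y_1 =
1` has positive probability, so the maximal mass of an invariant law spreads to every point
(`uniform_of_invariant`). -/

namespace Matchmaking

/-! ### Deterministic dynamics of a prompt schedule -/

section Deterministic

variable {k : ℕ} {a : ℕ → ℝ≥0} {G : Set Game}

theorem IsSchedule.startTime_eq (h : IsSchedule k a G) {g : Game} (hg : g ∈ G) {n : ℕ}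
    (hn : n ∈ g.players) : startTime G n = g.time := by
  refine le_antisymm (iInf₂_le_of_le g hg (iInf_le _ hn))
    (le_iInf₂ fun g' hg' => le_iInf fun hn' => ?_)
  have : g = g' := h.disjoint.elim_finset hg hg' n hn hn'
  rw [this]

theorem IsSchedule.startTime_le_iff (h : IsSchedule k a G) {n : ℕ} {t : ℝ≥0} :
    startTime G n ≤ t ↔ ∃ g ∈ G, n ∈ g.players ∧ g.time ≤ t := by
  constructor
  · intro hle
    have hlt : startTime G n < ⊤ := hle.trans_lt ENNReal.coe_lt_top
    simp only [startTime, iInf_lt_iff] at hlt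
    obtain ⟨g, hg, hn, -⟩ := hlt
    rw [h.startTime_eq hg hn] at hle
    exact ⟨g, hg, hn, by exact_mod_cast hle⟩
  · rintro ⟨g, hg, hn, hle⟩
    rw [h.startTime_eq hg hn]
    exact_mod_cast hle

theorem IsSchedule.started_subset (h : IsSchedule k a G) (t : ℝ≥0) :
    {n | startTime G n ≤ t} ⊆ {n | a n ≤ t} := by
  intro n hn
  obtain ⟨g, hg, hng, hle⟩ := h.startTime_le_iff.1 hn
  exact (h.arrival_le g hg n hng).trans hle

theorem IsSchedule.dvd_ncard_started (hk : 1 ≤ k) (h : IsSchedule k a G) {t : ℝ≥0}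
    (hfin : {n | a n ≤ t}.Finite) : k ∣ {n | startTime G n ≤ t}.ncard := by
  classical
  -- Distinct games have distinct player sets because `k ≥ 1` rules out empty games.
  have hinj : Set.InjOn Game.players {g ∈ G | g.time ≤ t} := by
    intro g hg g' hg' heq
    have hpos : 0 < g.players.card := by rw [h.card_eq g hg.1]; exact hk
    obtain ⟨n, hn⟩ := Finset.card_pos.1 hpos
    exact h.disjoint.elim_finset hg.1 hg'.1 n hn (heq ▸ hn)
  have hgames : {g ∈ G | g.time ≤ t}.Finite := by
    refine Set.Finite.of_finite_image ?_ hinj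
    refine (hfin.toFinset.powerset.finite_toSet).subset ?_
    rintro _ ⟨g, hg, rfl⟩
    simp only [Finset.coe_powerset, Set.Finite.coe_toFinset, Set.mem_preimage, Set.mem_powerset_iff]
    intro n hn
    exact (h.arrival_le g hg.1 n hn).trans hg.2
  have heq : {n | startTime G n ≤ t} = (hgames.toFinset.biUnion Game.players : Finset ℕ) := by
    ext n
    simp only [Set.mem_ofPred_eq, h.startTime_le_iff, Finset.coe_biUnion, Set.Finite.coe_toFinset,
      Set.mem_iUnion, Finset.mem_coe, exists_prop]
    constructor
    · rintro ⟨g, hg, hn, hle⟩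
      exact ⟨g, ⟨hg, hle⟩, hn⟩
    · rintro ⟨g, ⟨hg, hle⟩, hn⟩
      exact ⟨g, hg, hn, hle⟩
  rw [heq, Set.ncard_coe_finset, Finset.card_biUnion]
  · exact Finset.dvd_sum fun g hg => by
      rw [h.card_eq g ((Set.Finite.mem_toFinset _).1 hg).1]
  · intro g hg g' hg' hne
    exact h.disjoint ((Set.Finite.mem_toFinset _).1 hg).1 ((Set.Finite.mem_toFinset _).1 hg').1 hne

theorem StartsPromptly.queueLength_and_ncard_started (hp : StartsPromptly k a G) (hk : 1 ≤ k)
    (h : IsSchedule k a G) {t : ℝ≥0} (hfin : {n | a n ≤ t}.Finite) :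
    queueLength a G t = ({n | a n ≤ t}.ncard % k : ℕ) ∧
      {n | startTime G n ≤ t}.ncard = k * ({n | a n ≤ t}.ncard / k) := by
  have hq : queueLength a G t = ({n | a n ≤ t} \ {n | startTime G n ≤ t}).encard := by
    refine congrArg Set.encard (Set.ext fun n => ?_)
    simp
  obtain ⟨m, hm⟩ := h.dvd_ncard_started hk hfin
  have hsum := Set.ncard_sdiff_add_ncard_of_subset (h.started_subset t) hfin
  have hlt := hp t
  rw [hq] at hlt ⊢
  rw [← hfin.sdiff.cast_ncard_eq] at hlt ⊢
  have hlt' := Nat.cast_lt.1 hlt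
  rw [← hsum, hm]
  constructor
  · rw [Nat.add_mul_mod_self_left, Nat.mod_eq_of_lt hlt']
  · rw [Nat.add_mul_div_left _ _ hk, Nat.div_eq_of_lt hlt', zero_add]

/-- The players are matched in consecutive blocks of `k`, and each block starts a game when its
last player arrives. -/
theorem StartsPromptly.startTime_eq (hp : StartsPromptly k a G) (hk : 1 ≤ k)
    (h : IsSchedule k a G) (hfin : ∀ t, {n | a n ≤ t}.Finite) (hmono : Monotone a)
    (hstrict : ∀ p, k ≤ p + 1 → a p < a (p + 1)) (n : ℕ) :
    startTime G n = a (k * (n / k) + (k - 1)) := by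
  -- Strict growth is available only from index `k - 1` on: the initial players all arrive at time
  -- `0`.
  have hcount : ∀ p, k ≤ p + 1 → {n | a n ≤ a p}.ncard = p + 1 := by
    intro p hkp
    have : {n | a n ≤ a p} = Set.Iio (p + 1) := by
      ext m
      simp only [Set.mem_ofPred_eq, Set.mem_Iio]
      constructor
      · intro hle
        by_contra! hcon
        exact absurd ((hstrict p hkp).trans_le (hmono hcon)) (not_lt.2 hle)
      · intro hlt
        exact hmono (by omega)
    rw [this, Set.ncard_Iio_nat]
  -- When the last player of a block arrives, the number arrived is a multiple of `k`, so everyone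
  -- who has arrived has started.
  have hfull : ∀ m, ∀ i < k * m + k, startTime G i ≤ a (k * m + (k - 1)) := by
    intro m i hi
    set p := k * m + (k - 1) with hpdef
    have hc := hcount p (by omega)
    have hp1 : p + 1 = k * (m + 1) := by rw [mul_add]; omega
    have h2 := (hp.queueLength_and_ncard_started hk h (hfin (a p))).2
    rw [hc, hp1, Nat.mul_div_cancel_left _ hk, ← hp1, ← hc] at h2
    have := Set.eq_of_subset_of_ncard_le (h.started_subset (a p)) h2.ge (hfin _)
    have hi' : i ∈ {n | a n ≤ a p} := hmono (by omega)
    rw [← this] at hi'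
    exact hi'
  have hn := Nat.div_add_mod n k
  have hnk := Nat.mod_lt n hk
  set m := n / k
  refine le_antisymm (hfull m n (by omega)) ?_
  by_contra! hlt
  obtain ⟨t, ht, htp⟩ := ENNReal.lt_iff_exists_nnreal_btwn.1 hlt
  have htp : t < a (k * m + (k - 1)) := by exact_mod_cast htp
  have hnt : a n ≤ t := h.started_subset t ht.le
  -- If `n` had started by `t`, before its block is complete, then so had all `k * m` players of
  -- earlier blocks. But fewer than `k * (m + 1)` have arrived, which allows at most `k * m` starts.
  have hsub : Set.Iio (k * m) ∪ {n} ⊆ {i | startTime G i ≤ t} := by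
    rintro i (hi | hi)
    · rcases Nat.eq_zero_or_pos m with hm | hm
      · simp [hm] at hi
      · obtain ⟨m', hm'⟩ : ∃ m', m = m' + 1 := ⟨m - 1, by omega⟩
        rw [hm', mul_add, mul_one] at hi hn
        refine (hfull m' i hi).trans ?_
        exact_mod_cast (hmono (by omega)).trans hnt
    · rw [Set.mem_singleton_iff.1 hi]
      exact ht.le
  have hcard : k * m + 1 ≤ {i | startTime G i ≤ t}.ncard := by
    refine le_trans (le_of_eq ?_)
      (Set.ncard_le_ncard hsub ((hfin t).subset (h.started_subset t)))
    rw [Set.union_singleton, Set.ncard_insert_of_notMem (by simp; omega), Set.ncard_Iio_nat]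
  have harr : {i | a i ≤ t}.ncard ≤ k * m + (k - 1) := by
    rw [← Set.ncard_Iio_nat (k * m + (k - 1))]
    refine Set.ncard_le_ncard (fun i hi => ?_) (Set.finite_Iio _)
    by_contra! hcon
    exact absurd (htp.trans_le (hmono (not_lt.1 hcon))) (not_lt.2 hi)
  rw [(hp.queueLength_and_ncard_started hk h (hfin t)).2] at hcard
  have : {i | a i ≤ t}.ncard / k ≤ m := by
    rw [← Nat.lt_succ_iff, Nat.div_lt_iff_lt_mul hk, Nat.succ_mul, mul_comm]
    omega
  have := Nat.mul_le_mul_left k this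
  omega

/-- The number of arrivals up to time `t`, for inter-arrival times `g`. -/
noncomputable def arrivalCount (t : ℝ≥0) (g : ℕ → ℝ≥0) : ℕ :=
  sInf {n | t < ∑ i ∈ Finset.range (n + 1), g i}

variable {g : ℕ → ℝ≥0} {x : ℕ}

theorem arrivalTime_mono (g : ℕ → ℝ≥0) (x : ℕ) : Monotone (arrivalTime g x) :=
  fun _ _ h => Finset.sum_le_sum_of_subset (Finset.range_subset_range.2 (by omega))

theorem arrivalTime_lt_succ (hpos : ∀ n, 0 < g n) {p : ℕ} (hp : x ≤ p + 1) :
    arrivalTime g x p < arrivalTime g x (p + 1) := by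
  rw [arrivalTime, arrivalTime, show p + 1 + 1 - x = p + 1 - x + 1 by omega,
    Finset.sum_range_succ]
  exact lt_add_of_pos_right _ (hpos _)

theorem sum_le_iff_lt_arrivalCount
    (htop : Tendsto (fun n => ∑ i ∈ Finset.range n, g i) atTop atTop) (t : ℝ≥0) (n : ℕ) :
    ∑ i ∈ Finset.range (n + 1), g i ≤ t ↔ n < arrivalCount t g := by
  have hne : {n | t < ∑ i ∈ Finset.range (n + 1), g i}.Nonempty :=
    (((tendsto_add_atTop_iff_nat 1).2 htop).eventually_gt_atTop t).exists
  rw [← not_iff_not, not_le, not_lt]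
  constructor
  · exact fun h => Nat.sInf_le h
  · intro h
    exact (Nat.sInf_mem hne).trans_le
      (Finset.sum_le_sum_of_subset (Finset.range_subset_range.2 (Nat.succ_le_succ h)))

theorem arrived_eq_Iio (htop : Tendsto (fun n => ∑ i ∈ Finset.range n, g i) atTop atTop)
    (x : ℕ) (t : ℝ≥0) : {n | arrivalTime g x n ≤ t} = Set.Iio (x + arrivalCount t g) := by
  ext n
  simp only [Set.mem_ofPred_eq, Set.mem_Iio, arrivalTime]
  rcases lt_or_ge n x with h | h
  · rw [show n + 1 - x = 0 by omega]
    simp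
    omega
  · rw [show n + 1 - x = (n - x) + 1 by omega, sum_le_iff_lt_arrivalCount htop]
    omega

theorem queueLength_eq_mod (hk : 1 ≤ k)
    (htop : Tendsto (fun n => ∑ i ∈ Finset.range n, g i) atTop atTop)
    (h : IsSchedule k (arrivalTime g x) G) (hp : StartsPromptly k (arrivalTime g x) G)
    (t : ℝ≥0) :
    queueLength (arrivalTime g x) G t = ((x + arrivalCount t g) % k : ℕ) := by
  have hB := arrived_eq_Iio htop x t
  rw [(hp.queueLength_and_ncard_started hk h (hB ▸ Set.finite_Iio _)).1, hB, Set.ncard_Iio_nat]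

/-- A newcomer waits until their block of `k` players is complete. -/
theorem waitingTime_eq_sum (hk : 1 ≤ k) (hx : x ≤ k) (hpos : ∀ n, 0 < g n)
    (htop : Tendsto (fun n => ∑ i ∈ Finset.range n, g i) atTop atTop)
    (h : IsSchedule k (arrivalTime g x) G) (hp : StartsPromptly k (arrivalTime g x) G)
    (n : ℕ) :
    waitingTime (arrivalTime g x) G (x + n) =
      ∑ i ∈ Finset.range (k - 1 - (x + n) % k), (g (n + 1 + i) : ℝ≥0∞) := by
  rw [waitingTime, hp.startTime_eq hk h
    (fun t => (arrived_eq_Iio htop x t) ▸ Set.finite_Iio _) (arrivalTime_mono g x)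
    (fun p hkp => arrivalTime_lt_succ hpos (hx.trans hkp))]
  have h1 := Nat.div_add_mod (x + n) k
  have h2 := Nat.mod_lt (x + n) hk
  rw [arrivalTime, arrivalTime, show x + n + 1 - x = n + 1 by omega,
    show k * ((x + n) / k) + (k - 1) + 1 - x = n + 1 + (k - 1 - (x + n) % k) by omega,
    Finset.sum_range_add, ENNReal.coe_add, ENNReal.add_sub_cancel_left ENNReal.coe_ne_top,
    ENNReal.ofNNReal_finsetSum]

end Deterministic

/-! ### Exponential mean and averages over residue classes -/

theorem lintegral_expMeasure {lam : ℝ} (hlam : 0 < lam) :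
    ∫⁻ x, ENNReal.ofReal x ∂expMeasure lam = ENNReal.ofReal lam⁻¹ := by
  have hmeas (c : ℝ) : Measurable (gammaPDF c lam) :=
    (measurable_gammaPDFReal c lam).ennreal_ofReal
  rw [expMeasure, gammaMeasure, lintegral_withDensity_eq_lintegral_mul _ (hmeas 1)
    ENNReal.measurable_ofReal]
  -- Up to the factor `lam⁻¹`, `x` times the exponential density is the Gamma density of shape `2`,
  -- whose total mass is `1`.
  rw [show (gammaPDF 1 lam * fun x => ENNReal.ofReal x) =
    fun x => ENNReal.ofReal lam⁻¹ * gammaPDF 2 lam x from ?_, lintegral_const_mul _ (hmeas 2),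
    lintegral_gammaPDF_eq_one two_pos hlam, mul_one]
  funext x
  rcases lt_or_ge x 0 with hx | hx
  · simp [gammaPDF_of_neg hx]
  · rw [Pi.mul_apply, gammaPDF_of_nonneg hx, gammaPDF_of_nonneg hx,
      ← ENNReal.ofReal_mul' hx, ← ENNReal.ofReal_mul (inv_nonneg.2 hlam.le)]
    congr 1
    norm_num
    field_simp

/-- The averages of a nonnegative sequence converge if the averages along each residue class
modulo `k` do. -/
theorem tendsto_average_of_residues {k : ℕ} (hk : 1 ≤ k) {f : ℕ → ℝ} (hf : ∀ n, 0 ≤ f n)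
    {l : ℕ → ℝ}
    (h : ∀ r < k, Tendsto (fun M : ℕ => (∑ q ∈ Finset.range M, f (k * q + r)) / M) atTop
      (𝓝 (l r))) :
    Tendsto (fun N : ℕ => (∑ n ∈ Finset.range N, f n) / N) atTop
      (𝓝 ((∑ r ∈ Finset.range k, l r) / k)) := by
  have hk0 : (0 : ℝ) < k := by exact_mod_cast hk
  refine tendsto_div_of_monotone_of_exists_subseq_tendsto_div
    (fun N => ∑ n ∈ Finset.range N, f n) _
    (fun _ _ hab => Finset.sum_le_sum_of_subset_of_nonneg (Finset.range_subset_range.2 hab)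
      fun n _ _ => hf n) fun a ha => ⟨fun M => k * M, ?_, ?_, ?_⟩
  · have h1 : ∀ᶠ n : ℕ in atTop, (a - 1)⁻¹ ≤ n := tendsto_natCast_atTop_atTop.eventually_ge_atTop _
    filter_upwards [h1] with n hn
    rw [inv_le_iff_one_le_mul₀' (by linarith)] at hn
    push_cast
    nlinarith
  · exact tendsto_id.const_mul_atTop' (by omega)
  · have hblock : ∀ M : ℕ, ∑ n ∈ Finset.range (k * M), f n =
        ∑ r ∈ Finset.range k, ∑ q ∈ Finset.range M, f (k * q + r) := by
      intro M
      induction M with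
      | zero => simp
      | succ M ih =>
        rw [mul_add, mul_one, Finset.sum_range_add, ih, ← Finset.sum_add_distrib]
        simp_rw [Finset.sum_range_succ]
    have := (tendsto_finsetSum (Finset.range k)
      fun r hr => h r (Finset.mem_range.1 hr)).div_const (k : ℝ)
    refine this.congr fun M => ?_
    rw [hblock, ← Finset.sum_div, div_div, Nat.cast_mul, mul_comm (M : ℝ)]

theorem sum_range_add_mod {M : Type*} [AddCommMonoid M] (k x : ℕ) (f : ℕ → M) :
    ∑ r ∈ Finset.range k, f ((x + r) % k) = ∑ r ∈ Finset.range k, f r := by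
  conv_rhs => rw [← Nat.image_Ico_mod x k, Finset.sum_image (by exact Nat.mod_injOn_Ico x k),
    Finset.sum_Ico_eq_sum_range]
  simp

theorem sum_residues {k : ℕ} (hk : 1 ≤ k) (x : ℕ) :
    ∑ r ∈ Finset.range k, ((k - 1 - (x + r) % k : ℕ) : ℝ) = k * (k - 1) / 2 := by
  have hperm : ∑ r ∈ Finset.range k, (k - 1 - (x + r) % k) = ∑ r ∈ Finset.range k, r := by
    rw [sum_range_add_mod k x (fun i => k - 1 - i)]
    exact Finset.sum_range_reflect (fun i => i) k
  rw [← Nat.cast_sum, hperm]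
  have h2 := Finset.sum_range_id_mul_two k
  have h3 : ((∑ i ∈ Finset.range k, i : ℕ) : ℝ) * 2 = k * (k - 1) := by
    rw [← Nat.cast_pred hk]
    exact_mod_cast h2
  linarith

/-! ### Laws and long-run averages of the gaps -/

section Gaps

variable {Ω : Type*} [MeasurableSpace Ω] {P : Measure Ω} {lam : ℝ} {gap : ℕ → Ω → ℝ≥0}

namespace IsPoissonArrivals

theorem lintegral_gap (h : IsPoissonArrivals P lam gap) (hlam : 0 < lam) (n : ℕ) :
    ∫⁻ ω, (gap n ω : ℝ≥0∞) ∂P = ENNReal.ofReal lam⁻¹ := by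
  rw [← lintegral_expMeasure hlam,
    ← (h.law n).lintegral_comp ENNReal.measurable_ofReal.aemeasurable]
  simp

theorem measure_gap_le (h : IsPoissonArrivals P lam gap) (hlam : 0 < lam) (n : ℕ) (t : ℝ≥0) :
    P {ω | gap n ω ≤ t} = ENNReal.ofReal (1 - Real.exp (-(lam * t))) := by
  have := isProbabilityMeasure_expMeasure hlam
  have h1 := (h.law n).measure_eq (p := fun x => x ≤ (t : ℝ)) measurableSet_Iic
  simp only [NNReal.coe_le_coe] at h1
  rw [h1]
  change expMeasure lam (Set.Iic (t : ℝ)) = _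
  rw [← ofReal_cdf, cdf_expMeasure_eq hlam, if_pos (NNReal.coe_nonneg t)]

theorem ae_gap_pos (h : IsPoissonArrivals P lam gap) (hlam : 0 < lam) :
    ∀ᵐ ω ∂P, ∀ n, 0 < gap n ω := by
  refine ae_all_iff.2 fun n => ?_
  have := h.measure_gap_le hlam n 0
  simp only [NNReal.coe_zero, mul_zero, neg_zero, Real.exp_zero, sub_self,
    ENNReal.ofReal_zero] at this
  simpa [ae_iff] using this

theorem ae_tendsto_average (h : IsPoissonArrivals P lam gap) (hlam : 0 < lam) {k : ℕ}
    (hk : 1 ≤ k) (s : ℕ) :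
    ∀ᵐ ω ∂P, Tendsto (fun M : ℕ => (∑ q ∈ Finset.range M, (gap (k * q + s) ω : ℝ)) / M) atTop
      (𝓝 lam⁻¹) := by
  have hmeas (n : ℕ) : Measurable fun ω => (gap n ω : ℝ) := (h.measurable n).coe_nnreal_real
  have hmean (n : ℕ) : ∫ ω, (gap n ω : ℝ) ∂P = lam⁻¹ := by
    rw [integral_eq_lintegral_of_nonneg_ae (ae_of_all _ fun ω => NNReal.coe_nonneg _)
      (hmeas n).aestronglyMeasurable]
    simp only [ENNReal.ofReal_coe_nnreal]
    rw [h.lintegral_gap hlam, ENNReal.toReal_ofReal (inv_nonneg.2 hlam.le)]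
  -- A non-integrable function has Bochner integral `0`, but here the integral is `lam⁻¹ > 0`.
  have hint (n : ℕ) : Integrable (fun ω => (gap n ω : ℝ)) P := by
    by_contra hcon
    have := hmean n
    rw [integral_undef hcon] at this
    exact (inv_pos.2 hlam).ne this
  have := strong_law_ae_real (μ := P) (fun q ω => (gap (k * q + s) ω : ℝ)) (hint _) ?_ ?_
  · rwa [hmean] at this
  · intro i j hij
    have hne : k * i + s ≠ k * j + s := by
      simpa using ⟨hij, by omega⟩
    exact (h.indep.indepFun hne).comp measurable_coe_nnreal_real measurable_coe_nnreal_real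
  · intro i
    exact ⟨(hmeas _).aemeasurable, (hmeas _).aemeasurable,
      (h.law _).map_eq.trans (h.law _).map_eq.symm⟩

theorem ae_tendsto_sum (h : IsPoissonArrivals P lam gap) (hlam : 0 < lam) :
    ∀ᵐ ω ∂P, Tendsto (fun n => ∑ i ∈ Finset.range n, gap i ω) atTop atTop := by
  filter_upwards [h.ae_tendsto_average hlam le_rfl 0] with ω hω
  simp only [one_mul, add_zero] at hω
  have h1 := hω.pos_mul_atTop (inv_pos.2 hlam) tendsto_natCast_atTop_atTop
  rw [← NNReal.tendsto_coe_atTop]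
  refine h1.congr' ?_
  filter_upwards [eventually_gt_atTop 0] with n hn
  rw [div_mul_cancel₀ _ (by positivity)]
  push_cast
  rfl

end IsPoissonArrivals

end Gaps

/-! ### Invariant laws on a finite group -/

section Convolution

variable {Ω H : Type*} [MeasurableSpace Ω] {P : Measure Ω} [IsProbabilityMeasure P]
  [Fintype H] [MeasurableSpace H] [MeasurableSingletonClass H] {X Y : Ω → H}

theorem sum_measureReal_eq_one (hX : Measurable X) : ∑ i, P.real {ω | X ω = i} = 1 := by
  have := sum_measureReal_preimage_singleton (μ := P) (f := X) Finset.univ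
    (fun y _ => hX (measurableSet_singleton y))
  simpa [Set.preimage] using this

theorem measureReal_add_eq [AddGroup H] (hX : Measurable X) (hY : Measurable Y)
    (hXY : IndepFun X Y P) (j : H) :
    P.real {ω | X ω + Y ω = j} = ∑ i, P.real {ω | Y ω = i} * P.real {ω | X ω = j - i} := by
  have hunion : {ω | X ω + Y ω = j} = ⋃ i, (X ⁻¹' {j - i} ∩ Y ⁻¹' {i}) := by
    ext ω
    simp [eq_sub_iff_add_eq]
  have hdisj : Pairwise (Function.onFun Disjoint fun i => X ⁻¹' {j - i} ∩ Y ⁻¹' {i}) := by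
    intro i i' hne
    refine Set.disjoint_left.2 fun ω h h' => hne ?_
    exact h.2.symm.trans h'.2
  have hsing (i : H) : MeasurableSet {i} := measurableSet_singleton i
  rw [hunion, measureReal_def,
    measure_iUnion hdisj fun i => (hX (hsing _)).inter (hY (hsing _)), tsum_fintype,
    ENNReal.toReal_sum fun i _ => measure_ne_top _ _]
  refine Finset.sum_congr rfl fun i _ => ?_
  rw [hXY.measure_inter_preimage_eq_mul _ _ (hsing _) (hsing _), ENNReal.toReal_mul, mul_comm]
  rfl

theorem measureReal_add_eq_of_uniform [AddGroup H] (hX : Measurable X) (hY : Measurable Y)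
    (hXY : IndepFun X Y P) {c : ℝ} (hc : ∀ i, P.real {ω | X ω = i} = c) (j : H) :
    P.real {ω | X ω + Y ω = j} = c := by
  rw [measureReal_add_eq hX hY hXY]
  simp_rw [hc]
  rw [← Finset.sum_mul, sum_measureReal_eq_one hY, one_mul]

/-- If adding an independent `Y` does not change the law of `X`, then the law of `X` is invariant
under every translation to which `Y` gives positive mass, at its points of maximal mass. -/
theorem measureReal_sub_eq_max [AddGroup H] (hX : Measurable X) (hY : Measurable Y)
    (hXY : IndepFun X Y P)
    (hinv : ∀ j, P.real {ω | X ω + Y ω = j} = P.real {ω | X ω = j}) {j : H}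
    (hmax : ∀ i, P.real {ω | X ω = i} ≤ P.real {ω | X ω = j}) {i : H}
    (hi : 0 < P.real {ω | Y ω = i}) :
    P.real {ω | X ω = j - i} = P.real {ω | X ω = j} := by
  by_contra hne
  have hlt := lt_of_le_of_ne (hmax (j - i)) hne
  -- Invariance writes the maximal mass as a weighted average of masses; one smaller mass of
  -- positive weight would make it strictly smaller than itself.
  have : ∑ i, P.real {ω | Y ω = i} * P.real {ω | X ω = j - i} <
      ∑ i, P.real {ω | Y ω = i} * P.real {ω | X ω = j} :=
    Finset.sum_lt_sum (fun i _ => mul_le_mul_of_nonneg_left (hmax _) measureReal_nonneg)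
      ⟨i, Finset.mem_univ i, mul_lt_mul_of_pos_left hlt hi⟩
  rw [← measureReal_add_eq hX hY hXY, hinv, ← Finset.sum_mul, sum_measureReal_eq_one hY,
    one_mul] at this
  exact this.false

open Fin.CommRing in
-- Starting from a point of maximal mass, repeated translation by `1`, which generates the cyclic
-- group, reaches every point.
theorem uniform_of_invariant {k : ℕ} [NeZero k] {X Y : Ω → Fin k} (hX : Measurable X)
    (hY : Measurable Y) (hXY : IndepFun X Y P)
    (hinv : ∀ j, P.real {ω | X ω + Y ω = j} = P.real {ω | X ω = j})
    (h1 : 0 < P.real {ω | Y ω = 1}) (j : Fin k) : P.real {ω | X ω = j} = (k : ℝ)⁻¹ := by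
  obtain ⟨m, hm⟩ := Finite.exists_max fun j : Fin k => P.real {ω | X ω = j}
  have hstep (n : ℕ) : P.real {ω | X ω = m - (n : Fin k)} = P.real {ω | X ω = m} := by
    induction n with
    | zero => simp
    | succ n ih =>
      rw [← ih, Nat.cast_succ, ← sub_sub]
      exact measureReal_sub_eq_max hX hY hXY hinv (fun i => (hm i).trans_eq ih.symm) h1
  have hconst (i : Fin k) : P.real {ω | X ω = i} = P.real {ω | X ω = m} := by
    have := hstep (m - i).val
    rwa [Fin.cast_val_eq_self, sub_sub_cancel] at this
  have hsum := sum_measureReal_eq_one (P := P) hX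
  simp_rw [hconst] at hsum
  rw [Finset.sum_const, Finset.card_univ, Fintype.card_fin, nsmul_eq_mul] at hsum
  rw [hconst]
  exact eq_inv_of_mul_eq_one_right hsum

end Convolution

/-! ### Steady state of the queue length -/

theorem measurable_arrivalCount (t : ℝ≥0) : Measurable (arrivalCount t) := by
  refine measurable_to_nat fun g₀ => ?_
  have hS (n : ℕ) : MeasurableSet {g : ℕ → ℝ≥0 | t < ∑ i ∈ Finset.range (n + 1), g i} :=
    measurableSet_lt measurable_const
      (Finset.measurable_sum _ fun i _ => measurable_pi_apply i)
  generalize arrivalCount t g₀ = m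
  -- The second piece covers paths whose partial sums never exceed `t`, where `sInf ∅ = 0`.
  have heq : arrivalCount t ⁻¹' {m} =
      ({g | t < ∑ i ∈ Finset.range (m + 1), g i} ∩
        ⋂ j ∈ Set.Iio m, {g | t < ∑ i ∈ Finset.range (j + 1), g i}ᶜ) ∪
      ({_g | m = 0} ∩ ⋂ j, {g | t < ∑ i ∈ Finset.range (j + 1), g i}ᶜ) := by
    ext g
    simp only [Set.mem_preimage, Set.mem_singleton_iff, Set.mem_union, Set.mem_inter_iff,
      Set.mem_iInter, Set.mem_Iio, Set.mem_compl_iff, Set.mem_ofPred_eq, arrivalCount]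
    constructor
    · rintro rfl
      by_cases hne : {n | t < ∑ i ∈ Finset.range (n + 1), g i}.Nonempty
      · exact Or.inl ⟨Nat.sInf_mem hne, fun j hj => Nat.notMem_of_lt_sInf hj⟩
      · rw [Set.not_nonempty_iff_eq_empty] at hne
        refine Or.inr ⟨by rw [hne, Nat.sInf_empty], fun j hj => ?_⟩
        exact (hne ▸ hj : j ∈ (∅ : Set ℕ))
    · rintro (⟨hm, hlt⟩ | ⟨rfl, hj⟩)
      · refine le_antisymm (Nat.sInf_le hm) (le_csInf ⟨m, hm⟩ fun j hj => ?_)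
        by_contra! hcon
        exact hlt j hcon hj
      · rw [Nat.sInf_eq_zero]
        exact Or.inr (Set.eq_empty_of_forall_notMem hj)
  rw [heq]
  refine ((hS m).inter (MeasurableSet.biInter (Set.to_countable _) fun j _ => (hS j).compl)).union
    ((MeasurableSet.const _).inter (MeasurableSet.iInter fun j => (hS j).compl))

section SteadyState

variable {Ω : Type*} [MeasurableSpace Ω] {P : Measure Ω} {k : ℕ}
  {lam : ℝ} {gap : ℕ → Ω → ℝ≥0} {X₀ : Ω → Fin k} {G : Ω → Set Game}

/-- The number of arrivals up to time `t`, modulo `k`. -/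
noncomputable def arrivalResidue (k : ℕ) [NeZero k] (gap : ℕ → Ω → ℝ≥0) (t : ℝ≥0) (ω : Ω) :
    Fin k :=
  Fin.ofNat k (arrivalCount t fun n => gap n ω)

theorem IsPoissonArrivals.measurable_arrivalResidue [NeZero k]
    (h : IsPoissonArrivals P lam gap) (t : ℝ≥0) : Measurable (arrivalResidue k gap t) :=
  (measurable_from_nat (f := Fin.ofNat k)).comp
    ((measurable_arrivalCount t).comp (measurable_pi_lambda _ h.measurable))

theorem indepFun_arrivalResidue [NeZero k] (hindep : IndepFun X₀ (fun ω n => gap n ω) P)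
    (t : ℝ≥0) : IndepFun X₀ (arrivalResidue k gap t) P :=
  hindep.comp measurable_id
    ((measurable_from_nat (f := Fin.ofNat k)).comp (measurable_arrivalCount t))

theorem IsPoissonArrivals.ae_queueLength_eq [NeZero k] (h : IsPoissonArrivals P lam gap)
    (hlam : 0 < lam) (hG : IsPromptMechanism P gap X₀ G) :
    ∀ᵐ ω ∂P, ∀ t, queueLength (arrivals gap X₀ ω) (G ω) t =
      ((X₀ ω + arrivalResidue k gap t ω : Fin k) : ℕ) := by
  filter_upwards [hG, h.ae_tendsto_sum hlam] with ω hω htop t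
  have hk : 1 ≤ k := Nat.one_le_iff_ne_zero.2 (NeZero.ne k)
  rw [arrivals, queueLength_eq_mod hk htop hω.1 hω.2, Fin.val_add, arrivalResidue, Fin.val_ofNat,
    Nat.add_mod_mod]

theorem IsPoissonArrivals.ae_arrivalResidue_zero [NeZero k] (h : IsPoissonArrivals P lam gap)
    (hlam : 0 < lam) : ∀ᵐ ω ∂P, arrivalResidue k gap 0 ω = 0 := by
  filter_upwards [h.ae_gap_pos hlam] with ω hω
  have : arrivalCount 0 (fun n => gap n ω) = 0 :=
    Nat.sInf_eq_zero.2 (Or.inl (by simpa using hω 0))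
  rw [arrivalResidue, this]
  simp

/-- On the event `gap 0 ≤ 1 < gap 1`, of positive probability by independence, there is almost
surely exactly one arrival up to time `1`. -/
theorem IsPoissonArrivals.measureReal_arrivalResidue_one_pos [IsProbabilityMeasure P]
    [NeZero k] (h : IsPoissonArrivals P lam gap) (hlam : 0 < lam) :
    0 < P.real {ω | arrivalResidue k gap 1 ω = 1} := by
  have hle (n : ℕ) := h.measure_gap_le hlam n 1
  have hlaw : P {ω | gap 0 ω ≤ 1} ≠ 0 := by
    rw [hle]
    simpa using hlam
  have hlaw' : P {ω | 1 < gap 1 ω} ≠ 0 := by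
    have hc : {ω | 1 < gap 1 ω} = {ω | gap 1 ω ≤ 1}ᶜ := by
      ext ω
      simp
    rw [hc, Ne, prob_compl_eq_zero_iff (measurableSet_le (h.measurable 1) measurable_const), hle,
      ← ENNReal.ofReal_one]
    refine ((ENNReal.ofReal_lt_ofReal_iff one_pos).2 ?_).ne
    linarith [Real.exp_pos (-(lam * (1 : ℝ≥0)))]
  have hinter := (h.indep.indepFun zero_ne_one).measure_inter_preimage_eq_mul
    (Set.Iic 1) (Set.Ioi 1) measurableSet_Iic measurableSet_Ioi
  have hpos : P (gap 0 ⁻¹' Set.Iic 1 ∩ gap 1 ⁻¹' Set.Ioi 1) ≠ 0 := by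
    rw [hinter]
    exact mul_ne_zero hlaw hlaw'
  have htop := h.ae_tendsto_sum hlam
  refine ENNReal.toReal_pos (fun h0 => hpos (measure_mono_null_ae ?_ h0)) (measure_ne_top _ _)
  filter_upwards [htop] with ω htop hω
  have h1 : 0 < arrivalCount 1 fun n => gap n ω :=
    (sum_le_iff_lt_arrivalCount htop 1 0).1 (by simpa using hω.1)
  have h2 : ¬ 1 < arrivalCount 1 fun n => gap n ω := by
    rw [← sum_le_iff_lt_arrivalCount htop 1 1, not_le, Finset.sum_range_succ]
    exact lt_add_of_nonneg_of_lt zero_le hω.2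
  have h3 : arrivalCount 1 (fun n => gap n ω) = 1 := by omega
  change arrivalResidue k gap 1 ω = 1
  rw [arrivalResidue, h3]
  rfl

theorem IsPoissonArrivals.inSteadyState_iff_invariant [IsProbabilityMeasure P]
    [NeZero k] (h : IsPoissonArrivals P lam gap) (hlam : 0 < lam) (hG : IsPromptMechanism P gap X₀ G) :
    InSteadyState P gap X₀ G ↔ ∀ (t : ℝ≥0) (j : Fin k),
      P.real {ω | X₀ ω + arrivalResidue k gap t ω = j} = P.real {ω | X₀ ω = j} := by
  have hq (t : ℝ≥0) (j : ℕ) : P {ω | queueLength (arrivals gap X₀ ω) (G ω) t = j} =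
      P {ω | ((X₀ ω + arrivalResidue k gap t ω : Fin k) : ℕ) = j} := by
    refine measure_congr ?_
    filter_upwards [h.ae_queueLength_eq hlam hG] with ω hω
    refine propext ?_
    change queueLength (arrivals gap X₀ ω) (G ω) t = j ↔ _
    rw [hω t, Nat.cast_inj]
    rfl
  have hq0 (j : ℕ) : P {ω | queueLength (arrivals gap X₀ ω) (G ω) 0 = j} =
      P {ω | (X₀ ω : ℕ) = j} := by
    rw [hq]
    refine measure_congr ?_
    filter_upwards [h.ae_arrivalResidue_zero (k := k) hlam] with ω hω
    refine propext ?_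
    change ((X₀ ω + arrivalResidue k gap 0 ω : Fin k) : ℕ) = j ↔ (X₀ ω : ℕ) = j
    rw [hω, add_zero]
  have hfin : InSteadyState P gap X₀ G ↔ ∀ (t : ℝ≥0) (j : ℕ),
      P {ω | ((X₀ ω + arrivalResidue k gap t ω : Fin k) : ℕ) = j} = P {ω | (X₀ ω : ℕ) = j} := by
    simp only [InSteadyState, hq0, hq]
  simp only [hfin, measureReal_def, ENNReal.toReal_eq_toReal_iff' (measure_ne_top _ _)
    (measure_ne_top _ _)]
  constructor
  · intro hs t j
    simpa only [Fin.val_inj] using hs t j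
  · intro hs t j
    rcases lt_or_ge j k with hj | hj
    · have := hs t ⟨j, hj⟩
      simpa only [Fin.ext_iff] using this
    · have hne (i : Fin k) : (i : ℕ) ≠ j := (i.2.trans_le hj).ne
      simp [hne]

theorem IsPoissonArrivals.inSteadyState_iff_uniform [IsProbabilityMeasure P]
    [NeZero k] (h : IsPoissonArrivals P lam gap) (hlam : 0 < lam) (hX₀ : Measurable X₀)
    (hindep : IndepFun X₀ (fun ω n => gap n ω) P) (hG : IsPromptMechanism P gap X₀ G) :
    InSteadyState P gap X₀ G ↔ ∀ j : Fin k, P.real {ω | X₀ ω = j} = (k : ℝ)⁻¹ := by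
  rw [h.inSteadyState_iff_invariant hlam hG]
  constructor
  · exact fun hs => uniform_of_invariant hX₀ (h.measurable_arrivalResidue 1)
      (indepFun_arrivalResidue hindep 1) (hs 1) (h.measureReal_arrivalResidue_one_pos hlam)
  · intro hu t j
    rw [measureReal_add_eq_of_uniform hX₀ (h.measurable_arrivalResidue t)
      (indepFun_arrivalResidue hindep t) hu, hu]

end SteadyState

/-! ### Expected and long-run average waiting times -/

theorem tendsto_ofReal_average {f : ℕ → ℝ} (hf : ∀ n, 0 ≤ f n) {L : ℝ}
    (h : Tendsto (fun N : ℕ => (∑ n ∈ Finset.range N, f n) / N) atTop (𝓝 L)) :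
    Tendsto (fun N : ℕ => (∑ n ∈ Finset.range N, ENNReal.ofReal (f n)) / (N : ℝ≥0∞)) atTop
      (𝓝 (ENNReal.ofReal L)) := by
  refine (ENNReal.tendsto_ofReal h).congr' ?_
  filter_upwards [eventually_gt_atTop 0] with N hN
  rw [ENNReal.ofReal_div_of_pos (by exact_mod_cast hN),
    ENNReal.ofReal_sum_of_nonneg fun n _ => hf n, ENNReal.ofReal_natCast]

section Wait

variable {Ω : Type*} [MeasurableSpace Ω] {P : Measure Ω} {k : ℕ}
  {lam : ℝ} {gap : ℕ → Ω → ℝ≥0} {X₀ : Ω → Fin k} {G : Ω → Set Game}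

theorem IsPoissonArrivals.ae_wait_eq (h : IsPoissonArrivals P lam gap) (hlam : 0 < lam)
    (hG : IsPromptMechanism P gap X₀ G) :
    ∀ᵐ ω ∂P, ∀ n, wait gap X₀ G n ω =
      ∑ i ∈ Finset.range (k - 1 - (X₀ ω + n) % k), (gap (n + 1 + i) ω : ℝ≥0∞) := by
  filter_upwards [hG, h.ae_gap_pos hlam, h.ae_tendsto_sum hlam] with ω hω hpos htop n
  exact waitingTime_eq_sum (by have := (X₀ ω).pos; omega) (X₀ ω).2.le hpos htop hω.1 hω.2 n

theorem IsPoissonArrivals.lintegral_wait [IsFiniteMeasure P] (h : IsPoissonArrivals P lam gap)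
    (hlam : 0 < lam) (hX₀ : Measurable X₀) (hindep : IndepFun X₀ (fun ω n => gap n ω) P)
    (hG : IsPromptMechanism P gap X₀ G) (n : ℕ) :
    ∫⁻ ω, wait gap X₀ G n ω ∂P = ENNReal.ofReal
      (∑ j, P.real {ω | X₀ ω = j} * ((k - 1 - (j + n) % k : ℕ) * lam⁻¹)) := by
  classical
  let e (j : Fin k) (i : Fin k) : ℝ≥0∞ := if i = j then 1 else 0
  have hmeas (m : ℕ) : Measurable fun ω => (gap m ω : ℝ≥0∞) := (h.measurable m).coe_nnreal_ennreal
  have he (j : Fin k) : Measurable fun ω => e j (X₀ ω) :=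
    (Measurable.of_discrete (f := e j)).comp hX₀
  have hmul (j : Fin k) (m : ℕ) : Measurable fun ω => e j (X₀ ω) * (gap m ω : ℝ≥0∞) :=
    (he j).mul (hmeas m)
  have hprod (j : Fin k) (m : ℕ) : ∫⁻ ω, e j (X₀ ω) * (gap m ω : ℝ≥0∞) ∂P =
      P {ω | X₀ ω = j} * ENNReal.ofReal lam⁻¹ := by
    have hi : IndepFun (fun ω => e j (X₀ ω)) (fun ω => (gap m ω : ℝ≥0∞)) P :=
      hindep.comp (φ := e j) (ψ := fun g : ℕ → ℝ≥0 => (g m : ℝ≥0∞)) Measurable.of_discrete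
        (measurable_pi_apply m).coe_nnreal_ennreal
    rw [lintegral_mul_eq_lintegral_mul_lintegral_of_indepFun'' (he j).aemeasurable
      (hmeas m).aemeasurable hi, h.lintegral_gap hlam]
    congr 1
    rw [show (fun ω => e j (X₀ ω)) = (X₀ ⁻¹' {j}).indicator 1 by
      ext ω
      simp [e, Set.indicator]]
    exact lintegral_indicator_one (hX₀ (measurableSet_singleton j))
  -- Splitting by the value of `X₀` makes the number of summands deterministic, and each term is a
  -- product of independent factors.
  have hsplit : ∀ᵐ ω ∂P, wait gap X₀ G n ω = ∑ j : Fin k,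
      ∑ i ∈ Finset.range (k - 1 - (j + n) % k), e j (X₀ ω) * (gap (n + 1 + i) ω : ℝ≥0∞) := by
    filter_upwards [h.ae_wait_eq hlam hG] with ω hω
    rw [hω, Finset.sum_eq_single (X₀ ω)]
    · simp [e]
    · intro j _ hj
      simp [e, hj.symm]
    · simp
  rw [lintegral_congr_ae hsplit, lintegral_finsetSum _ fun j _ =>
      Finset.measurable_sum _ fun i _ => hmul _ _,
    ENNReal.ofReal_sum_of_nonneg fun j _ => by positivity]
  refine Finset.sum_congr rfl fun j _ => ?_
  rw [lintegral_finsetSum _ fun i _ => hmul _ _]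
  simp_rw [hprod]
  rw [Finset.sum_const, Finset.card_range, nsmul_eq_mul, ENNReal.ofReal_mul measureReal_nonneg,
    ENNReal.ofReal_mul (Nat.cast_nonneg _), ENNReal.ofReal_natCast,
    ofReal_measureReal (measure_ne_top _ _)]
  ring

theorem mean_wait_of_uniform (hk : 1 ≤ k) (n : ℕ) :
    ∑ j : Fin k, (k : ℝ)⁻¹ * ((k - 1 - (j + n) % k : ℕ) * lam⁻¹) = (k - 1) / (2 * lam) := by
  have hk0 : (k : ℝ) ≠ 0 := by exact_mod_cast (by omega : k ≠ 0)
  have := sum_residues hk n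
  rw [← Fin.sum_univ_eq_sum_range (fun r => ((k - 1 - (n + r) % k : ℕ) : ℝ)) k] at this
  rw [← Finset.mul_sum, ← Finset.sum_mul]
  simp_rw [add_comm _ n]
  rw [this]
  field_simp

theorem average_residues (hk : 1 ≤ k) (x : ℕ) :
    (∑ r ∈ Finset.range k, ((k - 1 - (x + r) % k : ℕ) : ℝ) * lam⁻¹) / k =
      (k - 1) / (2 * lam) := by
  have hk0 : (k : ℝ) ≠ 0 := by exact_mod_cast (by omega : k ≠ 0)
  rw [← Finset.sum_mul, sum_residues hk]
  field_simp

theorem add_mul_add_mod (x q r : ℕ) : (x + (k * q + r)) % k = (x + r) % k := by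
  rw [add_left_comm, Nat.mul_add_mod]

theorem IsPoissonArrivals.tendsto_average_lintegral_wait [IsProbabilityMeasure P]
    (h : IsPoissonArrivals P lam gap) (hlam : 0 < lam) (hk : 1 ≤ k) (hX₀ : Measurable X₀)
    (hindep : IndepFun X₀ (fun ω n => gap n ω) P) (hG : IsPromptMechanism P gap X₀ G) :
    Tendsto (fun N : ℕ => (∑ n ∈ Finset.range N, ∫⁻ ω, wait gap X₀ G n ω ∂P) / (N : ℝ≥0∞))
      atTop (𝓝 (ENNReal.ofReal ((k - 1) / (2 * lam)))) := by
  simp_rw [h.lintegral_wait hlam hX₀ hindep hG]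
  set f : ℕ → ℝ := fun n =>
    ∑ j, P.real {ω | X₀ ω = j} * ((k - 1 - (j + n) % k : ℕ) * lam⁻¹) with hfdef
  have hf (n : ℕ) : 0 ≤ f n := Finset.sum_nonneg fun j _ => by positivity
  have hper (q r : ℕ) : f (k * q + r) = f r := by simp only [hfdef, add_mul_add_mod]
  refine tendsto_ofReal_average hf ?_
  convert! tendsto_average_of_residues hk hf (l := f) fun r _ => ?_ using 2
  · rw [Finset.sum_comm, Finset.sum_div]
    simp_rw [← Finset.mul_sum, mul_div_assoc, average_residues hk]
    rw [← Finset.sum_mul, sum_measureReal_eq_one hX₀, one_mul]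
  · refine tendsto_const_nhds.congr' ?_
    filter_upwards [eventually_gt_atTop 0] with M hM
    simp_rw [hper]
    rw [Finset.sum_const, Finset.card_range, nsmul_eq_mul,
      mul_div_cancel_left₀ _ (by exact_mod_cast hM.ne')]

theorem IsPoissonArrivals.ae_tendsto_average_wait (h : IsPoissonArrivals P lam gap)
    (hlam : 0 < lam) (hk : 1 ≤ k) (hG : IsPromptMechanism P gap X₀ G) :
    ∀ᵐ ω ∂P, Tendsto (fun N : ℕ => (∑ n ∈ Finset.range N, wait gap X₀ G n ω) / (N : ℝ≥0∞))
      atTop (𝓝 (ENNReal.ofReal ((k - 1) / (2 * lam)))) := by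
  filter_upwards [h.ae_wait_eq hlam hG, ae_all_iff.2 (h.ae_tendsto_average hlam hk)]
    with ω hω hlim
  let f : ℕ → ℝ := fun n =>
    ∑ i ∈ Finset.range (k - 1 - (X₀ ω + n) % k), (gap (n + 1 + i) ω : ℝ)
  have hf (n : ℕ) : 0 ≤ f n := Finset.sum_nonneg fun i _ => NNReal.coe_nonneg _
  have hw (n : ℕ) : wait gap X₀ G n ω = ENNReal.ofReal (f n) := by
    rw [hω, ENNReal.ofReal_sum_of_nonneg fun i _ => NNReal.coe_nonneg _]
    simp
  simp_rw [hw]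
  refine tendsto_ofReal_average hf ?_
  rw [← average_residues hk (X₀ ω : ℕ)]
  refine tendsto_average_of_residues hk hf fun r _ => ?_
  have := tendsto_finsetSum (Finset.range (k - 1 - (X₀ ω + r) % k)) fun i _ => hlim (r + 1 + i)
  rw [Finset.sum_const, Finset.card_range, nsmul_eq_mul] at this
  refine this.congr fun M => ?_
  rw [← Finset.sum_div, Finset.sum_comm]
  simp only [f, add_mul_add_mod, add_assoc]

end Wait

end Matchmaking

theorem lemma1 {Ω : Type*} [MeasurableSpace Ω] (P : Measure Ω) [IsProbabilityMeasure P]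
    (k : ℕ) (hk : 1 ≤ k) (lam : ℝ) (hlam : 0 < lam)
    (gap : ℕ → Ω → ℝ≥0) (hgap : Matchmaking.IsPoissonArrivals P lam gap)
    (X₀ : Ω → Fin k) (hX₀ : Measurable X₀) (hindep : IndepFun X₀ (fun ω n => gap n ω) P)
    (G : Ω → Set Matchmaking.Game) (hG : Matchmaking.IsPromptMechanism P gap X₀ G) :
    -- the steady state is the one with the uniform distribution on `{0, …, k - 1}`
    (Matchmaking.InSteadyState P gap X₀ G ↔ ∀ j : Fin k, P {ω | X₀ ω = j} = (k : ℝ≥0∞)⁻¹) ∧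
    -- in steady state every arriving player has the stated expected waiting time
    (Matchmaking.InSteadyState P gap X₀ G →
      ∀ n, ∫⁻ ω, Matchmaking.wait gap X₀ G n ω ∂P = ENNReal.ofReal ((k - 1) / (2 * lam))) ∧
    -- from any initial state, the expected waiting time averaged over the arriving players
    Tendsto (fun N : ℕ =>
        (∑ n ∈ Finset.range N, ∫⁻ ω, Matchmaking.wait gap X₀ G n ω ∂P) / (N : ℝ≥0∞))
      atTop (𝓝 (ENNReal.ofReal ((k - 1) / (2 * lam)))) ∧
    -- from any initial state, the long-run average of the observed waiting times
    (∀ᵐ ω ∂P, Tendsto (fun N : ℕ =>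
        (∑ n ∈ Finset.range N, Matchmaking.wait gap X₀ G n ω) / (N : ℝ≥0∞))
      atTop (𝓝 (ENNReal.ofReal ((k - 1) / (2 * lam))))) := by

  have : NeZero k := ⟨by omega⟩
  have hsteady := hgap.inSteadyState_iff_uniform hlam hX₀ hindep hG
  refine ⟨hsteady.trans (forall_congr' fun j => ?_), fun hs n => ?_,
    hgap.tendsto_average_lintegral_wait hlam hk hX₀ hindep hG,
    hgap.ae_tendsto_average_wait hlam hk hG⟩
  · rw [measureReal_def, ← ENNReal.toReal_natCast, ← ENNReal.toReal_inv,
      ENNReal.toReal_eq_toReal_iff' (measure_ne_top _ _)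
        (ENNReal.inv_ne_top.2 (Nat.cast_ne_zero.2 (NeZero.ne k)))]
  · simp_rw [hgap.lintegral_wait hlam hX₀ hindep hG, hsteady.1 hs,
      Matchmaking.mean_wait_of_uniform hk]
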